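/- For $d,n\in\mathbb N$, a (possibly randomized) algorithm $\Phi:\mathbb R^d\times(\mathbb R^d)^n\to\mathbb R$ (that is, a Markov kernel from $\mathbb R^d\times(\mathbb R^d)^n$ to $\mathbb R$) is called an $\alpha$-accurate Mahalanobis norm estimator for $y\in\mathbb R^d$ using $n$ samples if for every positive definite $\Sigma\in\mathbb R^{d\times d}$, with $X_1,\dots,X_n$ i.i.d. from $\mathcal N(0,\Sigma)$, $$\Pr\Bigl((1-\alpha)\,y^\top\Sigma^{-1}y\le\Phi(y,X_1,\dots,X_n)\le(1+\alpha)\,y^\top\Sigma^{-1}y\Bigr)\ge 0.95,$$ where the probability is over the samples and the randomness of $\Phi$. Theorem. There are universal constants $c$, $0<c_1<1$ and $c_2>1$ such that for every $d\in\mathbb N$ with $d>c$ and every unit vector $y\in\mathbb R^d$ the following hold. 1. For every $n\in\mathbb N$, every $\frac12$-accurate Mahalanobis norm estimator for $y$ using $n$ samples satisfies $n\ge c_1 d$. 2. For every $n\in\mathbb N$ with $n>c_2 d$, the plug-in estimator $(y,X_1,\dots,X_n)\mapsto y^\top\hat\Sigma^{-1}y$, where $\hat\Sigma=\frac1n\sum_{i=1}^nX_iX_i^\top$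 is the empirical covariance, is a $\frac12$-accurate Mahalanobis norm estimator for $y$ using $n$ samples. -/

import Mathlib

open MeasureTheory ProbabilityTheory

/-- The Euclidean space `ℝ^d`. -/
abbrev Vec (d : ℕ) : Type := EuclideanSpace ℝ (Fin d)

/-- The quadratic form `yᵀ S⁻¹ y`. -/
noncomputable def mahalanobisForm {d : ℕ} (S : Matrix (Fin d) (Fin d) ℝ) (y : Vec d) : ℝ :=
  y.ofLp ⬝ᵥ (S⁻¹.mulVec y.ofLp)

/-- The joint law `N(0, S)^{⊗ n}` of `n` i.i.d. centred Gaussian samples. -/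
noncomputable def sampleLaw {d : ℕ} (n : ℕ) (S : Matrix (Fin d) (Fin d) ℝ) :
    Measure (Fin n → Vec d) :=
  Measure.pi fun _ => multivariateGaussian 0 S

/-- The law of the output `Φ (y, X₁, …, Xₙ)`, over both the samples `Xᵢ ∼ N(0, S)` i.i.d. and the
internal randomness of `Φ`. A (possibly randomized) algorithm `Φ : ℝ^d × (ℝ^d)^n → ℝ` is a Markov
kernel; the deterministic algorithms are the kernels `Kernel.deterministic`. -/
noncomputable def outputLaw {d n : ℕ} (Φ : Kernel (Vec d × (Fin n → Vec d)) ℝ)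
    (S : Matrix (Fin d) (Fin d) ℝ) (y : Vec d) : Measure ℝ :=
  (sampleLaw n S).bind (Φ.sectR y)

/-- `Φ` is an `α`-accurate Mahalanobis norm estimator for the vector `y`, using `n` samples: for
every positive definite covariance `S`, it is correct up to the relative error `α` with
probability at least `0.95`. -/
def IsAccurateFor {d n : ℕ} (α : ℝ) (Φ : Kernel (Vec d × (Fin n → Vec d)) ℝ) (y : Vec d) : Prop :=
  ∀ S : Matrix (Fin d) (Fin d) ℝ, S.PosDef →
    (0.95 : ℝ) ≤ (outputLaw Φ S y).real
      (Set.Icc ((1 - α) * mahalanobisForm S y) ((1 + α) * mahalanobisForm S y))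

/-- The empirical covariance `(1/n) ∑ Xᵢ Xᵢᵀ` of samples from a centred distribution. -/
noncomputable def empiricalCov {d n : ℕ} (X : Fin n → Vec d) : Matrix (Fin d) (Fin d) ℝ :=
  (n : ℝ)⁻¹ • ∑ i, Matrix.vecMulVec (X i).ofLp (X i).ofLp

theorem measurable_plugIn (d n : ℕ) :
    Measurable fun p : Vec d × (Fin n → Vec d) => mahalanobisForm (empiricalCov p.2) p.1 := by
  have hX : ∀ (k : Fin n) (i : Fin d),
      Measurable fun p : Vec d × (Fin n → Vec d) => (p.2 k).ofLp i := fun k i => by fun_prop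
  have hy : ∀ i : Fin d,
      Measurable fun p : Vec d × (Fin n → Vec d) => p.1.ofLp i := fun i => by fun_prop
  have hE : ∀ i j, Measurable fun p : Vec d × (Fin n → Vec d) => empiricalCov p.2 i j := by
    intro i j
    simp only [empiricalCov, Matrix.smul_apply, Matrix.sum_apply, Matrix.vecMulVec_apply,
      smul_eq_mul]
    exact measurable_const.mul (Finset.measurable_sum _ fun k _ => (hX k i).mul (hX k j))
  generalize hF : (fun p : Vec d × (Fin n → Vec d) => empiricalCov p.2) = F at *
  have hF' : ∀ p : Vec d × (Fin n → Vec d), empiricalCov p.2 = F p := fun p => congrFun hF p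
  simp only [hF'] at hE ⊢
  clear hF hF' hX
  have hI : ∀ i j, Measurable fun p : Vec d × (Fin n → Vec d) => (F p)⁻¹ i j := by
    intro i j
    simp only [Matrix.inv_def, Matrix.smul_apply, Ring.inverse_eq_inv', smul_eq_mul,
      Matrix.adjugate_apply, Matrix.det_apply']
    refine Measurable.mul (Measurable.inv ?_) ?_
    · exact Finset.measurable_sum _ fun σ _ => measurable_const.mul
        (Finset.measurable_prod _ fun k _ => hE _ _)
    · refine Finset.measurable_sum _ fun σ _ => measurable_const.mul
        (Finset.measurable_prod _ fun k _ => ?_)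
      by_cases h : σ k = j
      · simp only [Matrix.updateRow_apply, h, if_true]
        exact measurable_const
      · simpa only [Matrix.updateRow_apply, h, if_false] using hE _ _
  simp only [mahalanobisForm, dotProduct, Matrix.mulVec]
  exact Finset.measurable_sum _ fun i _ => (hy i).mul
    (Finset.measurable_sum _ fun j _ => (hI i j).mul (hy j))

/-- The (deterministic) plug-in estimator `(y, X) ↦ yᵀ Ŝ⁻¹ y`, where `Ŝ` is the empirical
covariance of the samples `X`. -/
noncomputable def plugInEstimator (d n : ℕ) : Kernel (Vec d × (Fin n → Vec d)) ℝ :=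
  Kernel.deterministic (fun p => mahalanobisForm (empiricalCov p.2) p.1) (measurable_plugIn d n)

/-!
A positive definite `S` is `A Aᵀ` with `A e₀ = s y` (`exists_factor_of_posDef`), and then
`N(0, S)` is the image of a standard Gaussian under `A` and `yᵀ (A W Aᵀ)⁻¹ y = s⁻² (W⁻¹)₀₀`
(`mahalanobisForm_conj`), so both bounds are about standard Gaussian matrices.

*Upper bound.* For the empirical covariance `W` of `n` standard Gaussian vectors, `n / (W⁻¹)₀₀` is the
squared distance of the first column of the `n × d` data matrix to the span of the other columns
(`inv_empiricalCov_mem_Icc`). Given the other columns, the first one is a Gaussian vector `a` of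
`ℝ^n`: `‖a‖²` is close to `n` by Chebyshev's inequality, and the squared length of the projection of
`a` to a subspace of dimension less than `d` has mean less than `d`, hence is small compared with `n`
by Markov's inequality (`stdSample_long_or_near_le`). Invertibility of `W` holds almost surely
because Gaussian vectors are in general position (`ae_linearIndependent_stdSample`).

*Lower bound.* In fact `n ≥ d` is necessary. Suppose `n < d`. Choose coordinates in which `y = e₀` and
consider samples `(⟨β, x'⟩ + σ z, x')` with `(z, x')` standard Gaussian: the covariance `S` satisfies
`yᵀ S⁻¹ y = σ⁻²`, so an accurate estimator distinguishes `σ = 1` from `σ = 1 / 2` for every `β`. But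
almost surely the `n` vectors `x'` are linearly independent, so there is `γ` with `⟨γ, x'⟩ = z` for
all samples, and the samples are those of the noiseless model with coefficients `β + σ γ`. For `β`
uniform in a ball whose radius tends to infinity, the shift by `σ γ` is negligible and the two values
of `σ` become indistinguishable (`false_of_separating_tests`).
-/

/-! ### Standard Gaussian matrices -/

/-- The law of `p` independent standard Gaussian vectors of `ℝ^q`, that is, of a `p × q` matrix with
independent standard Gaussian entries, given by its rows. -/
noncomputable abbrev stdSample (p q : ℕ) : Measure (Fin p → Vec q) :=
  Measure.pi fun _ => stdGaussian (Vec q)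

/-- The columns of a matrix that is given by its rows. -/
noncomputable def transposeVec {p q : ℕ} (X : Fin p → Vec q) : Fin q → Vec p :=
  fun j => WithLp.toLp 2 fun i => X i j

@[simp]
theorem transposeVec_apply {p q : ℕ} (X : Fin p → Vec q) (j : Fin q) (i : Fin p) :
    transposeVec X j i = X i j := rfl

theorem map_uncurry_swap_pi (p q : ℕ) :
    (Measure.pi fun _ : Fin p => Measure.pi fun _ : Fin q => gaussianReal 0 1).map
      (fun x (ij : Fin q × Fin p) => x ij.2 ij.1) = Measure.pi fun _ => gaussianReal 0 1 := by
  refine (Measure.pi_eq fun s hs => ?_).symm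
  rw [Measure.map_apply (by fun_prop) (MeasurableSet.univ_pi hs)]
  have : (fun (x : Fin p → Fin q → ℝ) (ij : Fin q × Fin p) => x ij.2 ij.1) ⁻¹' Set.univ.pi s =
      Set.univ.pi fun i => Set.univ.pi fun j => s (j, i) := by
    ext x
    simp only [Set.mem_preimage, Set.mem_pi, Set.mem_univ, true_implies, Prod.forall]
    exact forall_comm
  rw [this, Measure.pi_pi]
  simp only [Measure.pi_pi]
  rw [Finset.prod_comm, ← Finset.univ_product_univ, Finset.prod_product]

theorem map_uncurry_pi (p q : ℕ) :
    (Measure.pi fun _ : Fin q => Measure.pi fun _ : Fin p => gaussianReal 0 1).map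
      (fun x (ij : Fin q × Fin p) => x ij.1 ij.2) = Measure.pi fun _ => gaussianReal 0 1 := by
  refine (Measure.pi_eq fun s hs => ?_).symm
  rw [Measure.map_apply (by fun_prop) (MeasurableSet.univ_pi hs)]
  have : (fun (x : Fin q → Fin p → ℝ) (ij : Fin q × Fin p) => x ij.1 ij.2) ⁻¹' Set.univ.pi s =
      Set.univ.pi fun i => Set.univ.pi fun j => s (i, j) := by
    ext x
    simp only [Set.mem_preimage, Set.mem_pi, Set.mem_univ, true_implies, Prod.forall]
  rw [this, Measure.pi_pi]
  simp only [Measure.pi_pi]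
  rw [← Finset.univ_product_univ, Finset.prod_product]

theorem map_flip_pi (p q : ℕ) :
    (Measure.pi fun _ : Fin p => Measure.pi fun _ : Fin q => gaussianReal 0 1).map
      (fun x j i => x i j) =
      Measure.pi fun _ : Fin q => Measure.pi fun _ : Fin p => gaussianReal 0 1 := by
  have h := (map_uncurry_swap_pi p q).trans (map_uncurry_pi p q).symm
  have h2 := congrArg (Measure.map fun (x : Fin q × Fin p → ℝ) j i => x (j, i)) h
  rw [Measure.map_map (by fun_prop) (by fun_prop), Measure.map_map (by fun_prop) (by fun_prop)] at h2
  refine Eq.trans h2 ?_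
  exact Measure.map_id

theorem stdSample_eq_map (p q : ℕ) :
    stdSample p q = (Measure.pi fun _ : Fin p => Measure.pi fun _ : Fin q => gaussianReal 0 1).map
      (fun x i => WithLp.toLp 2 (x i)) := by
  have h : Measure.map (WithLp.toLp 2) (Measure.pi fun _ : Fin q => gaussianReal 0 1) =
    stdGaussian (Vec q) := map_pi_eq_stdGaussian
  have : SigmaFinite (Measure.map (WithLp.toLp 2) (Measure.pi fun _ : Fin q => gaussianReal 0 1)) := by
    rw [h]; infer_instance
  rw [Measure.pi_map_pi (f := fun _ : Fin p => WithLp.toLp 2) (fun _ => by fun_prop)]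
  simp only [h]

theorem measurePreserving_transposeVec (p q : ℕ) :
    MeasurePreserving transposeVec (stdSample p q) (stdSample q p) := by
  have hm : Measurable (transposeVec (p := p) (q := q)) := by
    unfold transposeVec; fun_prop
  refine ⟨hm, ?_⟩
  rw [stdSample_eq_map, stdSample_eq_map, Measure.map_map hm (by fun_prop), ← map_flip_pi p q,
    Measure.map_map (by fun_prop) (by fun_prop)]
  rfl

/-- A nondegenerate Gaussian does not charge proper subspaces. -/
theorem stdGaussian_submodule_eq_zero {q : ℕ} (V : Submodule ℝ (Vec q)) (hV : V ≠ ⊤) :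
    stdGaussian (Vec q) V = 0 := by
  obtain ⟨u, hu, hu0⟩ := (Submodule.ne_bot_iff _).1
    (fun h => hV ((Submodule.orthogonal_eq_bot_iff).1 h) : Vᗮ ≠ ⊥)
  have hmap : Measure.map (innerSL ℝ u) (stdGaussian (Vec q)) = gaussianReal 0 (‖u‖ ^ 2).toNNReal := by
    rw [IsGaussian.map_eq_gaussianReal, integral_strongDual_stdGaussian, variance_dual_stdGaussian,
      innerSL_apply_norm]
  have := nullSingletonClass_gaussianReal (μ := 0) (v := (‖u‖ ^ 2).toNNReal)
    (by simpa using hu0)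
  have h0 : Measure.map (innerSL ℝ u) (stdGaussian (Vec q)) {0} = 0 := by
    rw [hmap]; exact measure_singleton 0
  rw [Measure.map_apply (by fun_prop) (measurableSet_singleton 0)] at h0
  refine measure_mono_null (fun x hx => ?_) h0
  simpa using (Submodule.mem_orthogonal' V u).1 hu x hx

theorem measurableSet_linearIndependent (p q : ℕ) :
    MeasurableSet {X : Fin p → Vec q | LinearIndependent ℝ X} :=
  isOpen_setOfPred_linearIndependent.measurableSet

/-- By induction on `p`: a further Gaussian vector almost surely avoids the span of the previous
ones, which is a proper subspace. -/
theorem ae_linearIndependent_stdSample {p q : ℕ} (hpq : p ≤ q) :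
    ∀ᵐ X ∂stdSample p q, LinearIndependent ℝ X := by
  induction p with
  | zero => exact Filter.Eventually.of_forall fun X => linearIndependent_empty_type
  | succ p ih =>
    have hmp := (measurePreserving_piFinSuccAbove (fun _ : Fin (p + 1) => stdGaussian (Vec q)) 0)
    have hms : MeasurableSet {z : Vec q × (Fin p → Vec q) |
        LinearIndependent ℝ (Fin.cons z.1 z.2 : Fin (p + 1) → Vec q)} := by
      refine (measurableSet_linearIndependent (p + 1) q).preimage ?_
      refine measurable_pi_iff.2 fun i => ?_
      refine Fin.cases ?_ (fun j => ?_) i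
      · exact measurable_fst
      · exact (measurable_pi_apply j).comp measurable_snd
    have key : ∀ᵐ z ∂(stdGaussian (Vec q)).prod (stdSample p q),
        LinearIndependent ℝ (Fin.cons z.1 z.2 : Fin (p + 1) → Vec q) := by
      rw [Measure.ae_prod_iff_ae_ae hms, Measure.ae_ae_comm hms]
      filter_upwards [ih (by lia)] with Y hY
      have hne : Submodule.span ℝ (Set.range Y) ≠ ⊤ := by
        intro h
        have := finrank_span_eq_card hY
        rw [h, finrank_top] at this
        simp at this
        lia
      have := stdGaussian_submodule_eq_zero _ hne
      filter_upwards [measure_eq_zero_iff_ae_notMem.1 this] with x hx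
      exact linearIndependent_finCons.2 ⟨hY, hx⟩
    filter_upwards [hmp.quasiMeasurePreserving.ae key] with X hX
    convert hX using 1
    exact (Fin.cons_self_tail X).symm

/-! ### Linear images of standard Gaussian samples -/

theorem multivariateGaussian_mul_transpose {d : ℕ} (A : Matrix (Fin d) (Fin d) ℝ) :
    multivariateGaussian 0 (A * A.transpose) =
      (stdGaussian (Vec d)).map (Matrix.toEuclideanCLM (𝕜 := ℝ) A) := by
  apply Measure.ext_of_charFun
  ext t
  rw [charFun_multivariateGaussian
    (by simpa using Matrix.posSemidef_self_mul_conjTranspose A), charFun_apply,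
    integral_map (by fun_prop) (by fun_prop)]
  have h : ∀ x : Vec d, inner ℝ (Matrix.toEuclideanCLM (𝕜 := ℝ) A x) t =
      inner ℝ x (Matrix.toEuclideanCLM (𝕜 := ℝ) A.transpose t) := by
    intro x
    rw [Matrix.inner_toEuclideanCLM, real_inner_comm, Matrix.inner_toEuclideanCLM,
      Matrix.dotProduct_mulVec, Matrix.mulVec_transpose, dotProduct_comm]
  simp only [h]
  rw [← charFun_apply, charFun_stdGaussian, ← Complex.ofReal_pow, ← real_inner_self_eq_norm_sq,
    ← h, ← ContinuousLinearMap.comp_apply, ← ContinuousLinearMap.mul_def, ← map_mul,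
    real_inner_comm t (Matrix.toEuclideanCLM (𝕜 := ℝ) (A * A.transpose) t), Matrix.inner_toEuclideanCLM]
  simp [neg_div]

theorem sampleLaw_mul_transpose {d : ℕ} (n : ℕ) (A : Matrix (Fin d) (Fin d) ℝ) :
    sampleLaw n (A * A.transpose) =
      (stdSample n d).map (fun X i => Matrix.toEuclideanCLM (𝕜 := ℝ) A (X i)) := by
  rw [sampleLaw, multivariateGaussian_mul_transpose]
  have : SigmaFinite ((stdGaussian (Vec d)).map (Matrix.toEuclideanCLM (𝕜 := ℝ) A)) := by
    rw [← multivariateGaussian_mul_transpose]; infer_instance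
  exact (Measure.pi_map_pi (f := fun _ : Fin n => Matrix.toEuclideanCLM (𝕜 := ℝ) A)
    (fun _ => by fun_prop)).symm

/-- If `A` maps the first basis vector to `s • y`, then the coordinates given by `A` reduce the
Mahalanobis form of `A W Aᵀ` at `y` to an entry of `W⁻¹`. -/
theorem mahalanobisForm_conj {k : ℕ} {A : Matrix (Fin (k + 1)) (Fin (k + 1)) ℝ}
    (W : Matrix (Fin (k + 1)) (Fin (k + 1)) ℝ) {y : Vec (k + 1)} {s : ℝ} (hs : s ≠ 0)
    (hA : IsUnit A) (hy : A.mulVec (Pi.single 0 1) = s • y.ofLp) :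
    mahalanobisForm (A * W * A.transpose) y = (s ^ 2)⁻¹ * W⁻¹ 0 0 := by
  have hy' : y.ofLp = A.mulVec (s⁻¹ • Pi.single 0 1) := by
    rw [Matrix.mulVec_smul, hy, smul_smul, inv_mul_cancel₀ hs, one_smul]
  have hdet := (Matrix.isUnit_iff_isUnit_det A).1 hA
  rw [mahalanobisForm, hy', Matrix.mul_inv_rev, Matrix.mul_inv_rev, ← Matrix.mulVec_mulVec,
    ← Matrix.mulVec_mulVec, Matrix.mulVec_mulVec _ A⁻¹ A, Matrix.nonsing_inv_mul _ hdet,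
    Matrix.one_mulVec, ← Matrix.transpose_nonsing_inv, Matrix.dotProduct_mulVec,
    Matrix.vecMul_transpose, Matrix.mulVec_mulVec, Matrix.nonsing_inv_mul _ hdet,
    Matrix.one_mulVec]
  simp [Matrix.mulVec_smul]
  ring

/-- Every unit vector is the first column of an orthogonal matrix. -/
theorem exists_orthogonal_mulVec_single {k : ℕ} (y : Vec (k + 1)) (hy : ‖y‖ = 1) :
    ∃ O : Matrix (Fin (k + 1)) (Fin (k + 1)) ℝ, O * O.transpose = 1 ∧
      O.mulVec (Pi.single 0 1) = y.ofLp := by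
  obtain ⟨b, hb⟩ := Orthonormal.exists_orthonormalBasis_extension_of_card_eq (𝕜 := ℝ)
    (E := Vec (k + 1)) (ι := Fin (k + 1)) (by simp) (v := fun _ => y) (s := {0})
    (by
      rw [orthonormal_iff_ite]
      rintro ⟨i, hi⟩ ⟨j, hj⟩
      obtain rfl := hi
      obtain rfl := hj
      simp [Set.domRestrict, hy])
  refine ⟨Matrix.of fun i j => b j i, ?_, ?_⟩
  · rw [mul_eq_one_comm]
    ext i j
    have := (orthonormal_iff_ite.1 b.orthonormal) i j
    rw [PiLp.inner_apply] at this
    simp only [Matrix.mul_apply, Matrix.transpose_apply, Matrix.of_apply, Matrix.one_apply, ← this]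
    exact Finset.sum_congr rfl fun l _ => by simp [mul_comm]
  · ext i
    simp [hb 0 rfl]

/-! ### Concentration of norms and projections of Gaussian vectors -/

theorem integral_sq_gaussianReal : ∫ x, x ^ 2 ∂gaussianReal 0 1 = 1 := by
  have h := variance_of_integral_eq_zero (μ := gaussianReal 0 1) (X := id) (by fun_prop) (by simp)
  rw [variance_id_gaussianReal] at h
  simpa using h.symm

theorem memLp_sq_gaussianReal : MemLp (fun x : ℝ => x ^ 2) 2 (gaussianReal 0 1) := by
  have h := memLp_id_gaussianReal' (μ := 0) (v := 1) 4 (by simp)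
  rw [memLp_two_iff_integrable_sq (by fun_prop)]
  have h4 := MemLp.integrable_norm_pow (p := 4) (by exact_mod_cast h) (by norm_num)
  refine h4.congr (Filter.Eventually.of_forall fun x => ?_)
  simp only [id, Real.norm_eq_abs]
  rw [← pow_mul, Even.pow_abs (by decide)]

/-- Chebyshev's inequality for `‖a‖²`, which has mean `q`. -/
theorem stdGaussian_norm_sq_deviation (q : ℕ) {t : ℝ} (ht : 0 < t) :
    stdGaussian (Vec q) {a | t ≤ |‖a‖ ^ 2 - q|} ≤
      ENNReal.ofReal (q * Var[fun x => x ^ 2; gaussianReal 0 1] / t ^ 2) := by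
  have hm : MemLp (∑ i, fun ω : Fin q → ℝ => (ω i) ^ 2) 2
      (Measure.pi fun _ : Fin q => gaussianReal 0 1) :=
    memLp_finsetSum' _ fun i _ =>
      memLp_sq_gaussianReal.comp_measurePreserving (measurePreserving_eval _ i)
  have h := meas_ge_le_variance_div_sq hm ht
  rw [variance_sum_pi (X := fun (_ : Fin q) (x : ℝ) => x ^ 2) fun _ => memLp_sq_gaussianReal] at h
  have hint : ∫ x, (∑ i, fun ω : Fin q → ℝ => (ω i) ^ 2) x
      ∂(Measure.pi fun _ : Fin q => gaussianReal 0 1) = q := by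
    simp only [Finset.sum_apply]
    have hi : ∀ i ∈ Finset.univ, Integrable (fun ω : Fin q → ℝ => (ω i) ^ 2)
        (Measure.pi fun _ : Fin q => gaussianReal 0 1) := fun i _ =>
      (memLp_sq_gaussianReal.comp_measurePreserving
        (measurePreserving_eval (fun _ : Fin q => gaussianReal 0 1) i)).integrable (by norm_num)
    rw [integral_finsetSum _ hi]
    have : ∀ i : Fin q, ∫ ω : Fin q → ℝ, (ω i) ^ 2
        ∂(Measure.pi fun _ : Fin q => gaussianReal 0 1) = 1 := fun i =>
      (integral_comp_eval (μ := fun _ : Fin q => gaussianReal 0 1) (f := fun x : ℝ => x ^ 2)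
        (by fun_prop)).trans integral_sq_gaussianReal
    simp [this]
  rw [hint] at h
  rw [← map_pi_eq_stdGaussian, Measure.map_apply (by fun_prop)
    (measurableSet_le measurable_const (by fun_prop))]
  simpa [EuclideanSpace.real_norm_sq_eq] using h

theorem integral_inner_sq_stdGaussian {q : ℕ} (u : Vec q) :
    Integrable (fun a => (inner ℝ u a) ^ 2) (stdGaussian (Vec q)) ∧
      ∫ a, (inner ℝ u a) ^ 2 ∂stdGaussian (Vec q) = ‖u‖ ^ 2 := by
  refine ⟨(IsGaussian.memLp_two_id.const_inner u).integrable_sq, ?_⟩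
  have h := variance_of_integral_eq_zero (μ := stdGaussian (Vec q)) (X := innerSL ℝ u)
    (by fun_prop) (integral_strongDual_stdGaussian _)
  rw [variance_dual_stdGaussian, innerSL_apply_norm] at h
  simpa using h.symm

/-- Markov's inequality for the squared length of an orthogonal projection, whose mean is the
dimension of the subspace. -/
theorem stdGaussian_projection_tail {q : ℕ} (V : Submodule ℝ (Vec q)) {t : ℝ} (ht : 0 < t) :
    stdGaussian (Vec q) {a | t ≤ ‖V.orthogonalProjectionOnto a‖ ^ 2} ≤
      ENNReal.ofReal (Module.finrank ℝ V / t) := by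
  let b := stdOrthonormalBasis ℝ V
  have hnorm : ∀ a, ‖V.orthogonalProjectionOnto a‖ ^ 2 = ∑ i, (inner ℝ (b i : Vec q) a) ^ 2 := by
    intro a
    rw [← b.sum_sq_inner_right]
    refine Finset.sum_congr rfl fun i _ => ?_
    rw [Submodule.inner_orthogonalProjectionOnto_eq_of_mem_left]
  have hint : Integrable (fun a => ‖V.orthogonalProjectionOnto a‖ ^ 2) (stdGaussian (Vec q)) := by
    simp only [hnorm]
    exact integrable_finsetSum _ fun i _ => (integral_inner_sq_stdGaussian _).1
  have hval : ∫ a, ‖V.orthogonalProjectionOnto a‖ ^ 2 ∂stdGaussian (Vec q) = Module.finrank ℝ V := by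
    simp only [hnorm]
    rw [integral_finsetSum _ fun i _ => (integral_inner_sq_stdGaussian _).1]
    have hb : ∀ i, ‖(b i : Vec q)‖ = 1 := fun i => b.orthonormal.1 i
    simp [(integral_inner_sq_stdGaussian _).2, hb]
  have h := mul_meas_ge_le_integral_of_nonneg (μ := stdGaussian (Vec q))
    (f := fun a => ‖V.orthogonalProjectionOnto a‖ ^ 2)
    (Filter.Eventually.of_forall fun a => by positivity) hint t
  rw [hval] at h
  rw [← ENNReal.ofReal_toReal (measure_ne_top (stdGaussian (Vec q)) _)]
  apply ENNReal.ofReal_le_ofReal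
  rw [le_div_iff₀ ht, mul_comm]
  exact h

/-! ### The plug-in estimator -/

theorem empiricalCov_apply {k n : ℕ} (M : Fin k → Vec n) (i j : Fin k) :
    empiricalCov (transposeVec M) i j = (n : ℝ)⁻¹ * inner ℝ (M i) (M j) := by
  simp only [empiricalCov, Matrix.smul_apply, Matrix.sum_apply, Matrix.vecMulVec_apply, smul_eq_mul,
    PiLp.inner_apply, transposeVec_apply]
  congr 1
  exact Finset.sum_congr rfl fun l _ => by simp [mul_comm]

theorem empiricalCov_mulVec {k n : ℕ} (hn : 0 < n) (M : Fin k → Vec n) (v : Fin k → ℝ)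
    (i : Fin k) : inner ℝ (M i) (∑ j, v j • M j) =
      n * (empiricalCov (transposeVec M)).mulVec v i := by
  have : (n : ℝ) ≠ 0 := by positivity
  simp only [Matrix.mulVec, dotProduct, empiricalCov_apply, inner_sum, inner_smul_right,
    Finset.mul_sum]
  refine Finset.sum_congr rfl fun j _ => ?_
  field_simp

theorem isUnit_empiricalCov {k n : ℕ} (hn : 0 < n) (M : Fin k → Vec n)
    (hM : LinearIndependent ℝ M) : IsUnit (empiricalCov (transposeVec M)) := by
  rw [← Matrix.mulVec_injective_iff_isUnit]
  refine (injective_iff_map_eq_zero (Matrix.mulVecLin (empiricalCov (transposeVec M)))).2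
    fun v hv => ?_
  have h0 : ∀ i, inner ℝ (M i) (∑ j, v j • M j) = 0 := by
    intro i
    rw [empiricalCov_mulVec hn, ← Matrix.mulVecLin_apply, hv]
    simp
  have h1 : inner ℝ (∑ j, v j • M j) (∑ j, v j • M j) = 0 := by
    conv_lhs => rw [sum_inner]
    simp [inner_smul_left, h0]
  rw [inner_self_eq_zero] at h1
  exact funext (Fintype.linearIndependent_iff.1 hM v h1)

/-- The vector `w` with coefficients `Ŝ⁻¹ e₀` in the columns `M` of the data matrix is orthogonal to
all columns but the first, so `1 / (Ŝ⁻¹)₀₀` is the squared distance from the first column to the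
span of the others, divided by `n`. It lies between `2/3` and `2` when the distance is not too small
and the first column is not too long. -/
theorem inv_empiricalCov_mem_Icc {k n : ℕ} (hn : 0 < n) (M : Fin (k + 1) → Vec n)
    (hM : LinearIndependent ℝ M) (hlen : ‖M 0‖ ^ 2 ≤ 2 * n)
    (hfar : ∀ c : Fin k → ℝ, 2 * n / 3 ≤ ‖M 0 - ∑ j, c j • M j.succ‖ ^ 2) :
    (empiricalCov (transposeVec M))⁻¹ 0 0 ∈ Set.Icc (1 / 2 : ℝ) (3 / 2) := by
  have hn' : (0 : ℝ) < n := by positivity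
  set W := empiricalCov (transposeVec M) with hW
  set v : Fin (k + 1) → ℝ := W⁻¹.mulVec (Pi.single 0 1) with hv
  have hdet := (Matrix.isUnit_iff_isUnit_det W).1 (isUnit_empiricalCov hn M hM)
  have hWv : W.mulVec v = Pi.single 0 1 := by
    rw [hv, Matrix.mulVec_mulVec, Matrix.mul_nonsing_inv _ hdet, Matrix.one_mulVec]
  have hq : W⁻¹ 0 0 = v 0 := by simp [hv]
  set w := ∑ j, v j • M j with hw
  have h0 : inner ℝ (M 0) w = (n : ℝ) := by
    rw [hw, empiricalCov_mulVec hn, ← hW, hWv]; simp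
  have hS : ∀ j : Fin k, inner ℝ (M j.succ) w = 0 := by
    intro j
    rw [hw, empiricalCov_mulVec hn, ← hW, hWv]; simp
  have hww : ‖w‖ ^ 2 = n * v 0 := by
    rw [← real_inner_self_eq_norm_sq]
    nth_rewrite 1 [hw]
    rw [sum_inner, Fin.sum_univ_succ]
    simp [inner_smul_left, h0, hS, mul_comm]
  have hcs : (n : ℝ) ^ 2 ≤ ‖M 0‖ ^ 2 * (n * v 0) := by
    rw [← hww, ← mul_pow, ← h0]
    exact sq_le_sq' (by linarith [neg_le_of_abs_le (abs_real_inner_le_norm (M 0) w)])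
      (real_inner_le_norm _ _)
  have hv0 : 0 ≤ v 0 := by
    have : 0 ≤ n * v 0 := hww ▸ sq_nonneg _
    exact nonneg_of_mul_nonneg_right this hn'
  have hle : (n : ℝ) ^ 2 ≤ 2 * n * (n * v 0) :=
    hcs.trans (mul_le_mul_of_nonneg_right hlen (by positivity))
  have hlow : 1 / 2 ≤ v 0 := by
    have : (n : ℝ) ^ 2 * 1 ≤ n ^ 2 * (2 * v 0) := by linarith
    have := le_of_mul_le_mul_left this (by positivity)
    linarith
  refine ⟨hq ▸ hlow, hq ▸ ?_⟩
  have hpos : 0 < v 0 := by linarith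
  have hrep : M 0 - ∑ j : Fin k, (-(v 0)⁻¹ * v j.succ) • M j.succ = (v 0)⁻¹ • w := by
    rw [hw, Fin.sum_univ_succ, smul_add, smul_smul, inv_mul_cancel₀ hpos.ne', one_smul,
      Finset.smul_sum, sub_eq_add_neg, ← Finset.sum_neg_distrib]
    congr 1
    exact Finset.sum_congr rfl fun j _ => by rw [smul_smul, ← neg_smul]; ring_nf
  have h := hfar fun j => -(v 0)⁻¹ * v j.succ
  rw [hrep, norm_smul, mul_pow, hww, Real.norm_eq_abs, sq_abs] at h
  have h' : 2 * n / 3 * v 0 ≤ n := by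
    calc 2 * n / 3 * v 0 ≤ ((v 0)⁻¹ ^ 2 * (n * v 0)) * v 0 := by gcongr
      _ = n := by field_simp
  have : (n : ℝ) * (2 / 3 * v 0) ≤ n * 1 := by linarith
  have := le_of_mul_le_mul_left this hn'
  linarith

theorem empiricalCov_map {d n : ℕ} (A : Matrix (Fin d) (Fin d) ℝ) (X : Fin n → Vec d) :
    empiricalCov (fun i => Matrix.toEuclideanCLM (𝕜 := ℝ) A (X i)) =
      A * empiricalCov X * A.transpose := by
  simp only [empiricalCov, Matrix.ofLp_toEuclideanCLM, Matrix.mul_smul, Matrix.smul_mul,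
    Matrix.mul_sum, Matrix.sum_mul, Matrix.mul_vecMulVec, Matrix.vecMulVec_mul,
    Matrix.vecMul_transpose]

/-- For `b` fixed, a Gaussian vector is unlikely to be too long or too close to the span of `b`. -/
theorem stdGaussian_long_or_near_le {k n : ℕ} (hn : 0 < n) (b : Fin k → Vec n) :
    stdGaussian (Vec n) {a | 2 * n < ‖a‖ ^ 2 ∨ ∃ c : Fin k → ℝ,
      ‖a - ∑ j, c j • b j‖ ^ 2 < 2 * n / 3} ≤
      ENNReal.ofReal (36 * Var[fun x => x ^ 2; gaussianReal 0 1] / n + 6 * k / n) := by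
  have hn' : (0 : ℝ) < n := by positivity
  set V := Submodule.span ℝ (Set.range b)
  have hsub : {a | 2 * n < ‖a‖ ^ 2 ∨ ∃ c : Fin k → ℝ, ‖a - ∑ j, c j • b j‖ ^ 2 < 2 * n / 3} ⊆
      {a | (n : ℝ) / 6 ≤ |‖a‖ ^ 2 - n|} ∪
        {a | (n : ℝ) / 6 ≤ ‖V.orthogonalProjectionOnto a‖ ^ 2} := by
    intro a ha
    by_contra hcon
    simp only [Set.mem_union, Set.mem_ofPred_eq, not_or, not_le] at hcon
    obtain ⟨h1, h2⟩ := hcon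
    rw [abs_lt] at h1
    rcases ha with ha | ⟨c, hc⟩
    · linarith
    -- The component of `a` orthogonal to `V` has squared norm at least `5 n / 6 - n / 6`.
    · have hmem : ∑ j, c j • b j ∈ V :=
        Submodule.sum_mem _ fun j _ => Submodule.smul_mem _ _ (Submodule.subset_span ⟨j, rfl⟩)
      have hproj : Vᗮ.orthogonalProjectionOnto (a - ∑ j, c j • b j) =
          Vᗮ.orthogonalProjectionOnto a := by
        have h0 : Vᗮ.orthogonalProjectionOnto (∑ j, c j • b j) = 0 :=
          Submodule.orthogonalProjectionOnto_eq_zero_iff.2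
            (by rwa [Submodule.orthogonal_orthogonal])
        rw [map_sub, h0, sub_zero]
      have hle := Vᗮ.norm_orthogonalProjectionOnto_apply_le (a - ∑ j, c j • b j)
      rw [hproj] at hle
      have hsq := pow_le_pow_left₀ (norm_nonneg _) hle 2
      linarith [V.norm_sq_eq_add_norm_sq_projection a]
  have hdim : (Module.finrank ℝ V : ℝ) ≤ k := by
    exact_mod_cast (finrank_range_le_card b).trans (by simp)
  refine (measure_mono hsub).trans ((measure_union_le _ _).trans ?_)
  have hvar := variance_nonneg (fun x : ℝ => x ^ 2) (gaussianReal 0 1)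
  rw [ENNReal.ofReal_add (by positivity) (by positivity)]
  refine add_le_add ((stdGaussian_norm_sq_deviation n (by positivity)).trans
    (ENNReal.ofReal_le_ofReal (le_of_eq ?_)))
    ((stdGaussian_projection_tail V (by positivity)).trans (ENNReal.ofReal_le_ofReal ?_))
  · field_simp
    norm_num
  · rw [div_le_div_iff₀ (by positivity) hn']
    nlinarith

theorem stdSample_long_or_near_le {k n : ℕ} (hn : 0 < n) :
    stdSample (k + 1) n {M | 2 * n < ‖M 0‖ ^ 2 ∨ ∃ c : Fin k → ℝ,
      ‖M 0 - ∑ j, c j • M j.succ‖ ^ 2 < 2 * n / 3} ≤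
      ENNReal.ofReal (36 * Var[fun x => x ^ 2; gaussianReal 0 1] / n + 6 * k / n) := by
  have hmp := (measurePreserving_piFinSuccAbove (fun _ : Fin (k + 1) => stdGaussian (Vec n)) 0)
  -- Being close to the span is an open condition on the vector and the spanning family.
  have hms : MeasurableSet {z : Vec n × (Fin k → Vec n) | 2 * n < ‖z.1‖ ^ 2 ∨ ∃ c : Fin k → ℝ,
      ‖z.1 - ∑ j, c j • z.2 j‖ ^ 2 < 2 * n / 3} := by
    have hopen : IsOpen {z : Vec n × (Fin k → Vec n) | ∃ c : Fin k → ℝ,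
        ‖z.1 - ∑ j, c j • z.2 j‖ ^ 2 < 2 * n / 3} := by
      rw [Set.ofPred_exists]
      exact isOpen_iUnion fun c => isOpen_lt (by fun_prop) (by fun_prop)
    exact MeasurableSet.union (measurableSet_lt measurable_const
      (measurable_fst.norm.pow_const 2)) hopen.measurableSet
  have h := hmp.measure_preimage hms.nullMeasurableSet
  refine (le_of_eq h).trans ?_
  rw [Measure.prod_apply_symm hms]
  calc _ ≤ ∫⁻ _, ENNReal.ofReal (36 * Var[fun x => x ^ 2; gaussianReal 0 1] / n + 6 * k / n)
        ∂(stdSample k n) := lintegral_mono fun b => stdGaussian_long_or_near_le hn b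
    _ = _ := by simp

theorem outputLaw_apply {d n : ℕ} (Φ : Kernel (Vec d × (Fin n → Vec d)) ℝ)
    (S : Matrix (Fin d) (Fin d) ℝ) (y : Vec d) {s : Set ℝ} (hs : MeasurableSet s) :
    outputLaw Φ S y s = ∫⁻ X, Φ (y, X) s ∂sampleLaw n S := by
  rw [outputLaw, Measure.bind_apply hs (Kernel.measurable _).aemeasurable]
  simp [Kernel.sectR_apply]

open scoped MatrixOrder in
/-- A positive definite matrix is `A Aᵀ` where `A` maps the first basis vector to a multiple of a
given nonzero vector. -/
theorem exists_factor_of_posDef {k : ℕ} {S : Matrix (Fin (k + 1)) (Fin (k + 1)) ℝ}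
    (hS : S.PosDef) {y : Vec (k + 1)} (hy : y ≠ 0) :
    ∃ (A : Matrix (Fin (k + 1)) (Fin (k + 1)) ℝ) (s : ℝ), A * A.transpose = S ∧ IsUnit A ∧
      s ≠ 0 ∧ A.mulVec (Pi.single 0 1) = s • y.ofLp := by
  obtain ⟨B, hB⟩ : ∃ B : Matrix (Fin (k + 1)) (Fin (k + 1)) ℝ, S = B.transpose * B := by
    refine ⟨CFC.sqrt S, ?_⟩
    have hsa : (CFC.sqrt S).transpose = CFC.sqrt S := by
      rw [← Matrix.conjTranspose_eq_transpose_of_trivial]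
      exact (CFC.sqrt_nonneg S).isSelfAdjoint
    rw [hsa, CFC.sqrt_mul_sqrt_self S hS.posSemidef.nonneg]
  have hSu : IsUnit S.det := (Matrix.isUnit_iff_isUnit_det S).1 hS.isUnit
  have hBu : IsUnit B.det := by
    rw [hB, Matrix.det_mul] at hSu
    exact (IsUnit.mul_iff.1 hSu).2
  have hBu' : IsUnit B.transpose.det := by rwa [Matrix.det_transpose]
  set x : Vec (k + 1) := WithLp.toLp 2 (B.transpose⁻¹.mulVec y.ofLp) with hx
  have hBx : B.transpose.mulVec x.ofLp = y.ofLp := by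
    rw [hx, Matrix.mulVec_mulVec, Matrix.mul_nonsing_inv _ hBu', Matrix.one_mulVec]
  have hx0 : x ≠ 0 := by
    intro h
    apply hy
    ext i
    rw [← hBx, h]; simp
  obtain ⟨O, hO, hOe⟩ := exists_orthogonal_mulVec_single (‖x‖⁻¹ • x) (by
    rw [norm_smul, norm_inv, norm_norm, inv_mul_cancel₀ (norm_ne_zero_iff.2 hx0)])
  refine ⟨B.transpose * O, ‖x‖⁻¹, ?_, ?_, inv_ne_zero (norm_ne_zero_iff.2 hx0), ?_⟩
  · rw [Matrix.transpose_mul, Matrix.transpose_transpose, Matrix.mul_assoc, ← Matrix.mul_assoc O,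
      hO, Matrix.one_mul, hB]
  · exact ((Matrix.isUnit_iff_isUnit_det _).2 hBu').mul (IsUnit.of_mul_eq_one _ hO)
  · rw [← Matrix.mulVec_mulVec, hOe, WithLp.ofLp_smul, Matrix.mulVec_smul, hBx]

/-- Writing `S = A Aᵀ` with `A e₀ = s y`, the relative value of the plug-in estimator is the entry
`(0, 0)` of the inverse empirical covariance of a standard Gaussian sample. -/
theorem isAccurateFor_plugInEstimator {k n : ℕ}
    (hn : (240 + 1440 * Var[fun x => x ^ 2; gaussianReal 0 1]) * (k + 1) ≤ n) {y : Vec (k + 1)}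
    (hy : y ≠ 0) : IsAccurateFor (1 / 2) (plugInEstimator (k + 1) n) y := by
  have hvar := variance_nonneg (fun x : ℝ => x ^ 2) (gaussianReal 0 1)
  have hn' : (0 : ℝ) < n := lt_of_lt_of_le (by positivity) hn
  have hn0 : 0 < n := by exact_mod_cast hn'
  intro S hS
  obtain ⟨A, s, rfl, hAu, hs, hAy⟩ := exists_factor_of_posDef hS hy
  have hform : mahalanobisForm (A * A.transpose) y = (s ^ 2)⁻¹ := by
    simpa using mahalanobisForm_conj 1 hs hAu hAy
  have hs2 : 0 < (s ^ 2)⁻¹ := by positivity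
  rw [hform]
  set I := Set.Icc ((1 - 1 / 2) * (s ^ 2)⁻¹) ((1 + 1 / 2) * (s ^ 2)⁻¹)
  set bad := {M : Fin (k + 1) → Vec n | 2 * n < ‖M 0‖ ^ 2 ∨ ∃ c : Fin k → ℝ,
      ‖M 0 - ∑ j, c j • M j.succ‖ ^ 2 < 2 * n / 3}
  have hmeas : Measurable fun X : Fin n → Vec (k + 1) => mahalanobisForm (empiricalCov X) y :=
    (measurable_plugIn (k + 1) n).comp (measurable_const.prodMk measurable_id)
  have hout : outputLaw (plugInEstimator (k + 1) n) (A * A.transpose) y Iᶜ =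
      stdSample n (k + 1) {X | (s ^ 2)⁻¹ * (empiricalCov X)⁻¹ 0 0 ∈ Iᶜ} := by
    rw [outputLaw_apply _ _ _ measurableSet_Icc.compl]
    simp only [plugInEstimator, Kernel.deterministic_apply' _ _ measurableSet_Icc.compl]
    have : ∀ X : Fin n → Vec (k + 1), Set.indicator Iᶜ (fun _ => (1 : ENNReal))
        (mahalanobisForm (empiricalCov X) y) =
        Set.indicator ((fun X => mahalanobisForm (empiricalCov X) y) ⁻¹' Iᶜ) 1 X := fun X => rfl
    rw [lintegral_congr this, lintegral_indicator_one (hmeas measurableSet_Icc.compl), sampleLaw_mul_transpose,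
      Measure.map_apply (by fun_prop) (hmeas measurableSet_Icc.compl)]
    have hfun : ∀ X : Fin n → Vec (k + 1),
        mahalanobisForm (empiricalCov fun i => Matrix.toEuclideanCLM (𝕜 := ℝ) A (X i)) y =
          (s ^ 2)⁻¹ * (empiricalCov X)⁻¹ 0 0 := fun X => by
      rw [empiricalCov_map, mahalanobisForm_conj _ hs hAu hAy]
    refine congrArg _ (Set.ext fun X => ?_)
    change mahalanobisForm (empiricalCov fun i => Matrix.toEuclideanCLM (𝕜 := ℝ) A (X i)) y ∈ Iᶜ ↔
      (s ^ 2)⁻¹ * (empiricalCov X)⁻¹ 0 0 ∈ Iᶜ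
    rw [hfun]
  have hle : outputLaw (plugInEstimator (k + 1) n) (A * A.transpose) y Iᶜ ≤
      ENNReal.ofReal 0.05 := by
    rw [hout]
    have h1 : stdSample n (k + 1) {X | (s ^ 2)⁻¹ * (empiricalCov X)⁻¹ 0 0 ∈ Iᶜ} ≤
        stdSample (k + 1) n bad := by
      have hkn : k + 1 ≤ n := by
        have : ((k + 1 : ℕ) : ℝ) ≤ n := by push_cast; nlinarith
        exact_mod_cast this
      refine ((measurePreserving_transposeVec n (k + 1)).measure_preimage_le bad).trans' ?_
      refine measure_mono_ae ?_
      filter_upwards [(measurePreserving_transposeVec n (k + 1)).quasiMeasurePreserving.ae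
        (ae_linearIndependent_stdSample hkn)] with X hX hXI
      by_contra hgood
      apply hXI
      have hgood' : ¬ (2 * n < ‖transposeVec X 0‖ ^ 2 ∨ ∃ c : Fin k → ℝ,
        ‖transposeVec X 0 - ∑ j, c j • transposeVec X j.succ‖ ^ 2 < 2 * n / 3) := hgood
      push Not at hgood'
      have := inv_empiricalCov_mem_Icc hn0 (transposeVec X) hX hgood'.1 hgood'.2
      have hXX : transposeVec (transposeVec X) = X := rfl
      rw [hXX] at this
      constructor <;> nlinarith [this.1, this.2]
    refine h1.trans ((stdSample_long_or_near_le hn0).trans (ENNReal.ofReal_le_ofReal ?_))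
    rw [← add_div, div_le_iff₀ hn']
    nlinarith
  have : IsProbabilityMeasure (outputLaw (plugInEstimator (k + 1) n) (A * A.transpose) y) := by
    have : IsProbabilityMeasure (sampleLaw n (A * A.transpose)) := by
      rw [sampleLaw]; infer_instance
    have : IsMarkovKernel (plugInEstimator (k + 1) n) := by
      rw [plugInEstimator]; infer_instance
    rw [outputLaw]; infer_instance
  have hreal := ENNReal.toReal_mono ENNReal.ofReal_ne_top hle
  rw [ENNReal.toReal_ofReal (by norm_num)] at hreal
  have hcompl := probReal_compl_eq_one_sub (μ := outputLaw (plugInEstimator (k + 1) n)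
    (A * A.transpose) y) (s := I) measurableSet_Icc
  rw [Measure.real] at hcompl
  linarith

/-! ### A family of covariances with an unidentifiable residual variance -/

/-- The matrix sending `(x₀, x')` to `(σ x₀ + ⟨β, x'⟩, x')`. A standard Gaussian vector is sent to a
regression model with regressors `x'`, coefficients `β` and residual variance `σ²`. -/
noncomputable def regressionMatrix {k : ℕ} (σ : ℝ) (β : Vec k) :
    Matrix (Fin (k + 1)) (Fin (k + 1)) ℝ :=
  Matrix.of (Fin.cons (Fin.cons σ β.ofLp) fun i => Pi.single i.succ 1)

theorem regressionMatrix_mulVec {k : ℕ} (σ : ℝ) (β : Vec k) (x : Fin (k + 1) → ℝ) :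
    (regressionMatrix σ β).mulVec x =
      Fin.cons (σ * x 0 + ∑ j, β j * x j.succ) fun j => x j.succ := by
  ext i
  refine Fin.cases ?_ (fun i => ?_) i
  · simp [regressionMatrix, Matrix.mulVec, dotProduct, Fin.sum_univ_succ]
  · simp [regressionMatrix, Matrix.mulVec]

theorem isUnit_regressionMatrix {k : ℕ} {σ : ℝ} (hσ : σ ≠ 0) (β : Vec k) :
    IsUnit (regressionMatrix σ β) := by
  rw [← Matrix.mulVec_injective_iff_isUnit]
  intro x x' h
  simp only [regressionMatrix_mulVec] at h
  obtain ⟨h0, h1⟩ := Fin.cons_inj.1 h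
  have hs : ∀ j : Fin k, x j.succ = x' j.succ := fun j => congrFun h1 j
  simp only [hs, add_left_inj] at h0
  ext i
  exact Fin.cases (mul_left_cancel₀ hσ h0) hs i

/-- The samples of law `N(0, A Aᵀ)`, where `A = O * regressionMatrix σ β`, obtained from a standard
Gaussian sample. -/
noncomputable def regressionSample {k n : ℕ} (O : Matrix (Fin (k + 1)) (Fin (k + 1)) ℝ) (σ : ℝ)
    (β : Vec k) (X : Fin n → Vec (k + 1)) : Fin n → Vec (k + 1) :=
  fun i => Matrix.toEuclideanCLM (𝕜 := ℝ) (O * regressionMatrix σ β) (X i)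

theorem regressionSample_apply {k n : ℕ} (O : Matrix (Fin (k + 1)) (Fin (k + 1)) ℝ) (σ : ℝ)
    (β : Vec k) (X : Fin n → Vec (k + 1)) (i : Fin n) : regressionSample O σ β X i =
      Matrix.toEuclideanCLM (𝕜 := ℝ) O (WithLp.toLp 2
        (Fin.cons (σ * X i 0 + ∑ j, β j * X i j.succ) fun j => X i j.succ)) := by
  rw [regressionSample, map_mul, ContinuousLinearMap.mul_def, ContinuousLinearMap.comp_apply]
  congr 1
  ext j
  rw [Matrix.ofLp_toEuclideanCLM, regressionMatrix_mulVec]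

theorem measurable_regressionSample {k n : ℕ} (O : Matrix (Fin (k + 1)) (Fin (k + 1)) ℝ)
    (σ : ℝ) : Measurable fun p : Vec k × (Fin n → Vec (k + 1)) =>
      regressionSample O σ p.1 p.2 := by
  refine measurable_pi_iff.2 fun i => ?_
  simp only [regressionSample_apply]
  refine (Matrix.toEuclideanCLM (𝕜 := ℝ) O).measurable.comp
    ((WithLp.measurable_toLp 2 (Fin (k + 1) → ℝ)).comp ?_)
  refine measurable_pi_iff.2 fun j => Fin.cases ?_ (fun j => ?_) j
  · simp only [Fin.cons_zero]; fun_prop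
  · simp only [Fin.cons_succ]; fun_prop

/-- If the regressors fit the residuals, then the residuals can be traded for a change of the
regression coefficients. -/
theorem regressionSample_eq_shift {k n : ℕ} (O : Matrix (Fin (k + 1)) (Fin (k + 1)) ℝ)
    {γ : Vec k} {X : Fin n → Vec (k + 1)} (hγ : ∀ i, ∑ j, γ j * X i j.succ = X i 0) (σ : ℝ)
    (β : Vec k) : regressionSample O σ β X = regressionSample O 0 (β + σ • γ) X := by
  funext i
  have h : σ * X i 0 + ∑ j, β j * X i j.succ =
      0 * X i 0 + ∑ j, (β + σ • γ) j * X i j.succ := by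
    rw [← hγ i, zero_mul, zero_add, Finset.mul_sum, ← Finset.sum_add_distrib]
    refine Finset.sum_congr rfl fun j _ => ?_
    simp only [PiLp.add_apply, PiLp.smul_apply, smul_eq_mul]
    ring
  rw [regressionSample_apply, regressionSample_apply, h]

theorem exists_linear_relation {k n : ℕ} {x : Fin n → Vec k} (hx : LinearIndependent ℝ x)
    (z : Fin n → ℝ) : ∃ γ : Vec k, ∀ i, ∑ j, γ j * x i j = z i := by
  obtain ⟨g, hg⟩ := LinearMap.exists_leftInverse_of_injective (Fintype.linearCombination ℝ x)
    (LinearMap.ker_eq_bot'.2 fun c hc => funext (Fintype.linearIndependent_iff.1 hx c hc))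
  let φ : Vec k →ₗ[ℝ] ℝ := (Fintype.linearCombination ℝ z) ∘ₗ g
  refine ⟨(InnerProductSpace.toDual ℝ (Vec k)).symm φ.toContinuousLinearMap, fun i => ?_⟩
  have h := InnerProductSpace.toDual_symm_apply (𝕜 := ℝ) (x := x i) (y := φ.toContinuousLinearMap)
  have hgi : g (x i) = Pi.single i 1 := by
    have := LinearMap.congr_fun hg (Pi.single i 1)
    simpa [Fintype.linearCombination_apply_single] using this
  rw [PiLp.inner_apply] at h
  simp only [RCLike.inner_apply, conj_trivial] at h
  simp only [mul_comm _ (x i _)]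
  rw [h]
  simp [φ, hgi, Fintype.linearCombination_apply_single]

/-- With at most `k` samples, the first coordinates of the samples are exactly fitted by a linear
function of the other `k` coordinates. -/
theorem ae_exists_linear_relation {k n : ℕ} (hnk : n ≤ k) :
    ∀ᵐ X ∂stdSample n (k + 1), ∃ γ : Vec k, ∀ i, ∑ j, γ j * X i j.succ = X i 0 := by
  have hmp := ((measurePreserving_transposeVec k n).comp (measurePreserving_snd.comp
    (measurePreserving_piFinSuccAbove (fun _ : Fin (k + 1) => stdGaussian (Vec n)) 0))).comp
      (measurePreserving_transposeVec n (k + 1))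
  filter_upwards [hmp.quasiMeasurePreserving.ae (ae_linearIndependent_stdSample hnk)] with X hX
  exact exists_linear_relation hX fun i => X i 0

/-! ### Averaging over a flat prior -/

theorem setLIntegral_ball_add_le {k : ℕ} (f : Vec k → ENNReal) (γ : Vec k) {N r : ℝ}
    (hr : ‖γ‖ ≤ r) : ∫⁻ β in Metric.ball 0 N, f (β + γ) ≤ ∫⁻ β in Metric.ball 0 (N + r), f β := by
  rw [← lintegral_indicator Metric.isOpen_ball.measurableSet,
    ← lintegral_indicator Metric.isOpen_ball.measurableSet,
    ← lintegral_add_right_eq_self ((Metric.ball (0 : Vec k) (N + r)).indicator f) γ]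
  refine lintegral_mono fun β => ?_
  by_cases hβ : β ∈ Metric.ball (0 : Vec k) N
  · have : β + γ ∈ Metric.ball (0 : Vec k) (N + r) := by
      rw [mem_ball_zero_iff] at hβ ⊢
      linarith [norm_add_le β γ]
    rw [Set.indicator_of_mem hβ, Set.indicator_of_mem this]
  · rw [Set.indicator_of_notMem hβ]; exact zero_le

theorem tendsto_volume_ball_ratio (k : ℕ) (r : ℝ) (hr : 0 ≤ r) :
    Filter.Tendsto (fun N : ℕ => (volume (Metric.ball (0 : Vec k) (N + 1)))⁻¹ *
      volume (Metric.ball (0 : Vec k) (N + 1 + r))) Filter.atTop (nhds 1) := by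
  have h1 : Filter.Tendsto (fun N : ℕ => ENNReal.ofReal ((1 + r * (1 / ((N : ℝ) + 1))) ^ k))
      Filter.atTop (nhds 1) := by
    have : Filter.Tendsto (fun N : ℕ => (1 + r * (1 / ((N : ℝ) + 1))) ^ k)
        Filter.atTop (nhds ((1 + r * 0) ^ k)) :=
      ((tendsto_one_div_add_atTop_nhds_zero_nat.const_mul r).const_add 1).pow k
    simpa using ENNReal.tendsto_ofReal this
  refine h1.congr fun N => ?_
  have hN : (0 : ℝ) < N + 1 := by positivity
  have hv0 : volume (Metric.ball (0 : Vec k) 1) ≠ 0 := (Metric.measure_ball_pos _ _ one_pos).ne'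
  have hvt : volume (Metric.ball (0 : Vec k) 1) ≠ ⊤ := measure_ball_lt_top.ne
  have hNr : (0 : ℝ) < N + 1 + r := by positivity
  rw [Measure.addHaar_ball_of_pos volume (0 : Vec k) hN,
    Measure.addHaar_ball_of_pos volume (0 : Vec k) hNr, finrank_euclideanSpace_fin, mul_comm (_⁻¹),
    ← div_eq_mul_inv, ENNReal.mul_div_mul_right _ _ hv0 hvt,
    ← ENNReal.ofReal_div_of_pos (by positivity), ← div_pow]
  congr 2
  field_simp

/-- Two test functions with sum at most one cannot both have large mean, under the
residual standard deviations `1` and `1/2` respectively, for all regression coefficients: when there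
are at most `k` samples, the residuals are absorbed by a shift of the coefficients, which is
negligible under a flat prior. -/
theorem false_of_separating_tests {k n : ℕ} (hnk : n ≤ k)
    (O : Matrix (Fin (k + 1)) (Fin (k + 1)) ℝ) {F G : (Fin n → Vec (k + 1)) → ENNReal}
    (hFm : Measurable F) (hGm : Measurable G) (hFG : ∀ X, F X + G X ≤ 1)
    (hF : ∀ β : Vec k, ENNReal.ofReal 0.95 ≤ ∫⁻ X,
      F (regressionSample O 1 β X) ∂stdSample n (k + 1))
    (hG : ∀ β : Vec k, ENNReal.ofReal 0.95 ≤ ∫⁻ X,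
      G (regressionSample O (1 / 2) β X) ∂stdSample n (k + 1)) : False := by
  set T : ℝ → Vec k → (Fin n → Vec (k + 1)) → Fin n → Vec (k + 1) := regressionSample O
  have hTm : ∀ σ, Measurable fun p : Vec k × (Fin n → Vec (k + 1)) => T σ p.1 p.2 :=
    fun σ => measurable_regressionSample O σ
  have hshift : ∀ (γ : Vec k) (X : Fin n → Vec (k + 1)),
      (∀ i, ∑ j, γ j * X i j.succ = X i 0) → ∀ σ β, T σ β X = T 0 (β + σ • γ) X :=
    fun γ X hγ σ β => regressionSample_eq_shift O hγ σ β
  clear_value T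
  have hHm : Measurable fun p : Vec k × (Fin n → Vec (k + 1)) =>
      F (T 1 p.1 p.2) + G (T (1 / 2) p.1 p.2) := (hFm.comp (hTm 1)).add (hGm.comp (hTm _))
  have hFX : ∀ σ β, Measurable fun X => F (T σ β X) := fun σ β =>
    (hFm.comp (hTm σ)).comp measurable_prodMk_left
  have hFβ : ∀ σ X, Measurable fun β => F (T σ β X) := fun σ X =>
    (hFm.comp (hTm σ)).comp measurable_prodMk_right
  have hF1 : ∀ X, F X ≤ 1 := fun X => le_self_add.trans (hFG X)
  have hG1 : ∀ X, G X ≤ 1 := fun X => le_add_self.trans (hFG X)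
  set V : ℕ → ENNReal := fun N => volume (Metric.ball (0 : Vec k) (N + 1))
  have hV0 : ∀ N, V N ≠ 0 := fun N => (Metric.measure_ball_pos _ _ (by positivity)).ne'
  have hVt : ∀ N, V N ≠ ⊤ := fun N => measure_ball_lt_top.ne
  -- The sum of the two test functions, averaged over coefficients uniform in a large ball.
  set J : ℕ → (Fin n → Vec (k + 1)) → ENNReal := fun N X =>
    (V N)⁻¹ * ∫⁻ β in Metric.ball (0 : Vec k) (N + 1), (F (T 1 β X) + G (T (1 / 2) β X)) with hJ
  have hJm : ∀ N, Measurable (J N) := fun N =>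
    measurable_const.mul (Measurable.lintegral_prod_left hHm)
  have hJle : ∀ N X, J N X ≤ 2 := by
    intro N X
    calc J N X ≤ (V N)⁻¹ * ∫⁻ β in Metric.ball (0 : Vec k) (N + 1), 2 := by
          simp only [hJ]
          gcongr with β
          exact (add_le_add (hF1 _) (hG1 _)).trans (by norm_num)
      _ = 2 := by
          rw [setLIntegral_const, mul_left_comm]
          change 2 * ((V N)⁻¹ * V N) = 2
          rw [ENNReal.inv_mul_cancel (hV0 N) (hVt N), mul_one]
  have hJint : ∀ N, ENNReal.ofReal 1.9 ≤ ∫⁻ X, J N X ∂stdSample n (k + 1) := by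
    intro N
    simp only [hJ]
    rw [lintegral_const_mul _ (Measurable.lintegral_prod_left hHm),
      lintegral_lintegral_swap (f := fun X β => F (T 1 β X) + G (T (1 / 2) β X))
        (hHm.comp measurable_swap).aemeasurable]
    have hle : ENNReal.ofReal 1.9 * V N ≤ ∫⁻ β in Metric.ball (0 : Vec k) (N + 1),
        ∫⁻ X, (F (T 1 β X) + G (T (1 / 2) β X)) ∂stdSample n (k + 1) := by
      rw [← setLIntegral_const]
      refine lintegral_mono fun β => ?_
      rw [lintegral_add_left (hFX 1 β)]
      refine le_trans ?_ (add_le_add (hF β) (hG β))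
      rw [← ENNReal.ofReal_add (by norm_num) (by norm_num)]
      exact ENNReal.ofReal_le_ofReal (by norm_num)
    calc ENNReal.ofReal 1.9 = (V N)⁻¹ * (ENNReal.ofReal 1.9 * V N) := by
          rw [mul_left_comm, ENNReal.inv_mul_cancel (hV0 N) (hVt N), mul_one]
      _ ≤ _ := by gcongr
  have hlim : ∀ᵐ X ∂stdSample n (k + 1), Filter.limsup (fun N => J N X) Filter.atTop ≤ 1 := by
    filter_upwards [ae_exists_linear_relation hnk] with X ⟨γ, hγ⟩
    have hbound : ∀ N : ℕ, J N X ≤ (V N)⁻¹ * volume (Metric.ball (0 : Vec k) (N + 1 + ‖γ‖)) := by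
      intro N
      simp only [hJ]
      gcongr
      rw [lintegral_add_left (hFβ 1 X)]
      -- Both terms are averages of noiseless samples over a shifted ball.
      simp only [hshift γ X hγ 1, hshift γ X hγ (1 / 2)]
      have e1 := setLIntegral_ball_add_le (fun β => F (T 0 β X)) ((1 : ℝ) • γ) (N := N + 1)
        (r := ‖γ‖) (by rw [one_smul])
      have e2 := setLIntegral_ball_add_le (fun β => G (T 0 β X)) ((1 / 2 : ℝ) • γ) (N := N + 1)
        (r := ‖γ‖) (by rw [norm_smul]; norm_num; linarith [norm_nonneg γ])
      refine (add_le_add e1 e2).trans ?_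
      rw [← lintegral_add_left (hFβ 0 X)]
      exact (lintegral_mono fun β => hFG _).trans (by simp)
    refine (Filter.limsup_le_limsup (Filter.Eventually.of_forall hbound)).trans ?_
    exact (tendsto_volume_ball_ratio k ‖γ‖ (norm_nonneg _)).limsup_eq.le
  have hfatou := limsup_lintegral_le (μ := stdSample n (k + 1)) (f := J) (fun _ => 2) hJm
    (fun N => Filter.Eventually.of_forall (hJle N)) (by simp)
  have hupper : ∫⁻ X, Filter.limsup (fun N => J N X) Filter.atTop ∂stdSample n (k + 1) ≤ 1 :=
    (lintegral_mono_ae hlim).trans (by simp)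
  have hlower : ENNReal.ofReal 1.9 ≤
      Filter.limsup (fun N => ∫⁻ X, J N X ∂stdSample n (k + 1)) Filter.atTop :=
    Filter.le_limsup_of_frequently_le (Filter.Frequently.of_forall hJint)
  have := (hlower.trans hfatou).trans hupper
  rw [ENNReal.ofReal_le_one] at this
  norm_num at this

/-! ### The lower bound on the number of samples -/

/-- Accuracy of `Φ` at the covariances of the regression family, where `yᵀ S⁻¹ y = σ⁻²` whatever
the coefficients `β` are. -/
theorem lintegral_ge_of_isAccurateFor {k n : ℕ} {Φ : Kernel (Vec (k + 1) × (Fin n → Vec (k + 1))) ℝ}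
    [IsMarkovKernel Φ] {y : Vec (k + 1)} (h : IsAccurateFor (1 / 2) Φ y)
    {O : Matrix (Fin (k + 1)) (Fin (k + 1)) ℝ} (hO : IsUnit O)
    (hOy : O.mulVec (Pi.single 0 1) = y.ofLp) {σ : ℝ} (hσ : σ ≠ 0) (β : Vec k) :
    ENNReal.ofReal 0.95 ≤ ∫⁻ X,
      Φ (y, regressionSample O σ β X)
        (Set.Icc (1 / 2 * (σ ^ 2)⁻¹) (3 / 2 * (σ ^ 2)⁻¹)) ∂stdSample n (k + 1) := by
  set A := O * regressionMatrix σ β with hA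
  have hAu : IsUnit A := hO.mul (isUnit_regressionMatrix hσ β)
  have hAy : A.mulVec (Pi.single 0 1) = σ • y.ofLp := by
    have : (regressionMatrix σ β).mulVec (Pi.single 0 1) = σ • Pi.single 0 1 := by
      rw [regressionMatrix_mulVec]
      ext i
      refine Fin.cases ?_ (fun i => ?_) i <;> simp
    rw [hA, ← Matrix.mulVec_mulVec, this, Matrix.mulVec_smul, hOy]
  have hpos : (A * A.transpose).PosDef := by
    have := Matrix.PosDef.mul_conjTranspose_self A
      (Matrix.vecMul_injective_iff_isUnit.2 hAu)
    rwa [Matrix.conjTranspose_eq_transpose_of_trivial] at this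
  have hacc := h _ hpos
  have hform : mahalanobisForm (A * A.transpose) y = (σ ^ 2)⁻¹ := by
    simpa using mahalanobisForm_conj 1 hσ hAu hAy
  rw [hform] at hacc
  have hlaw := ENNReal.ofReal_le_of_le_toReal hacc
  have hm : ∀ s : Set ℝ, MeasurableSet s → Measurable fun X => Φ (y, X) s := fun s hs =>
    (Kernel.measurable_coe Φ hs).comp measurable_prodMk_left
  rw [outputLaw_apply _ _ _ measurableSet_Icc, sampleLaw_mul_transpose,
    lintegral_map (hm _ measurableSet_Icc) (by fun_prop)] at hlaw
  norm_num at hlaw ⊢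
  exact hlaw

/-- An accurate estimator needs at least as many samples as dimensions. -/
theorem lt_of_isAccurateFor {k n : ℕ} {Φ : Kernel (Vec (k + 1) × (Fin n → Vec (k + 1))) ℝ}
    [IsMarkovKernel Φ] {y : Vec (k + 1)} (hy : ‖y‖ = 1) (h : IsAccurateFor (1 / 2) Φ y) :
    k < n := by
  by_contra! hnk
  obtain ⟨O, hO, hOy⟩ := exists_orthogonal_mulVec_single y hy
  have hOu : IsUnit O := IsUnit.of_mul_eq_one _ hO
  refine false_of_separating_tests hnk O
    (F := fun X => Φ (y, X) (Set.Icc (1 / 2 * ((1 : ℝ) ^ 2)⁻¹) (3 / 2 * ((1 : ℝ) ^ 2)⁻¹)))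
    (G := fun X => Φ (y, X) (Set.Icc (1 / 2 * ((1 / 2 : ℝ) ^ 2)⁻¹) (3 / 2 * ((1 / 2 : ℝ) ^ 2)⁻¹)))
    ((Kernel.measurable_coe Φ measurableSet_Icc).comp measurable_prodMk_left)
    ((Kernel.measurable_coe Φ measurableSet_Icc).comp measurable_prodMk_left) (fun X => ?_)
    (fun β => lintegral_ge_of_isAccurateFor h hOu hOy one_ne_zero β)
    (fun β => lintegral_ge_of_isAccurateFor h hOu hOy (by norm_num) β)
  -- The two intervals `[1/2, 3/2]` and `[2, 6]` are disjoint.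
  rw [← measure_union (Set.disjoint_left.2 fun x h1 h2 => by
    have := h1.2; have := h2.1; norm_num at *; linarith) measurableSet_Icc]
  exact prob_le_one

theorem mainTheorem4 :
    ∃ c c₁ c₂ : ℝ, 0 < c₁ ∧ c₁ < 1 ∧ 1 < c₂ ∧
      ∀ d : ℕ, c < d → ∀ y : Vec d, ‖y‖ = 1 →
        (∀ (n : ℕ) (Φ : Kernel (Vec d × (Fin n → Vec d)) ℝ), IsMarkovKernel Φ →
          IsAccurateFor (1 / 2) Φ y → c₁ * d ≤ n) ∧
        (∀ n : ℕ, c₂ * d < n →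
          IsAccurateFor (1 / 2) (plugInEstimator d n) y) := by
  have hvar := variance_nonneg (fun x : ℝ => x ^ 2) (gaussianReal 0 1)
  -- For `n ≥ (240 + 1440 v) d` both terms of the error bound `36 v / n + 6 (d - 1) / n` are at most
  -- `1 / 40`, where `v` is the variance of the square of a standard Gaussian.
  refine ⟨0, 1 / 2, 240 + 1440 * Var[fun x => x ^ 2; gaussianReal 0 1], by norm_num, by norm_num,
    by linarith, fun d hd y hy => ?_⟩
  obtain ⟨k, rfl⟩ : ∃ k, d = k + 1 :=
    ⟨d - 1, (Nat.succ_pred_eq_of_pos (by exact_mod_cast hd)).symm⟩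
  refine ⟨fun n Φ _ h => ?_, fun n hn => ?_⟩
  · have hkn : ((k + 1 : ℕ) : ℝ) ≤ n := by exact_mod_cast lt_of_isAccurateFor hy h
    have : (0 : ℝ) ≤ ((k + 1 : ℕ) : ℝ) := by positivity
    linarith
  · exact isAccurateFor_plugInEstimator (by push_cast at hn; exact hn.le)
      (norm_ne_zero_iff.1 (by rw [hy]; exact one_ne_zero))
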